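/- Let $N$ be a natural number and let $\mathcal S$ be a set system on $[N]=\{1,\dots,N\}$ consisting of $M\ge 1$ distinct subsets. Its combinatorial discrepancy is $$\operatorname{disc}(\mathcal S)=\min_{\chi:[N]\to\{-1,1\}}\ \max_{S\in\mathcal S}\Big|\sum_{s\in S}\chi(s)\Big|.$$ A quantum coloring is an $N\times N$ complex Hermitian matrix with eigenvalues in $\{-1,1\}$. For a nonempty finite set $\mathcal P$ of orthogonal projections of $\mathbb C^N$ (a projection system), the quantum discrepancy is $$\operatorname{qdisc}(\mathcal P)=\min_{\chi\ \text{quantum coloring}}\ \max_{P\in\mathcal P}\Big[\big(\operatorname{tr}(\chi P)\big)^2+\operatorname{tr}\big(\chi[\chi,P]P\big)\Big]^{1/2},\qquad [A,B]=AB-BA.$$ Let $\mathcal P_{\mathcal S}=\{P_S: S\in\mathcal S\}$, where $P_S$ is the orthogonal projection of $\mathbb C^N$ onto the span of the standard basis vectors $e_i$, $i\in S$. Then: (i) For every $\varepsilon>0$ there is a constant $c=c(\varepsilon)>0$, depending only on $\varepsilon$ (not on $N$, $M$ or $\mathcal S$), such that if $\operatorname{qdisc}(\mathcal P_{\mathcal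 S})\ge\varepsilon$, then $$\operatorname{qdisc}(\mathcal P_{\mathcal S})>\frac{1}{2c\log(2M)+1}\operatorname{disc}(\mathcal S).$$ (ii) For every $\alpha>0$ there is a constant $c=c(\alpha)>0$, depending only on $\alpha$ (not on $N$, $M$ or $\mathcal S$), such that if $\operatorname{qdisc}(\mathcal P_{\mathcal S})\ge\alpha\sqrt{\log(2M)}$, then $$\operatorname{qdisc}(\mathcal P_{\mathcal S})>\frac{1}{2c\sqrt{\log(2M)}+1}\operatorname{disc}(\mathcal S).$$ -/

import Mathlib

/-! ### Combinatorial discrepancy -/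

/-- A set system on `[N]`: a (finite) collection of distinct subsets of `[N]`. -/
abbrev SetSystem (N : ℕ) := Finset (Finset (Fin N))

/-- A (two-)coloring of `[N]`: a function with values in `{-1, 1}`. -/
def IsColoring {N : ℕ} (χ : Fin N → ℤ) : Prop := ∀ i, χ i = -1 ∨ χ i = 1

/-- `disc 𝒮 = min_χ max_{S ∈ 𝒮} |χ(S)|`, where `χ(S) = ∑_{s ∈ S} χ(s)` and `χ` runs over all
colorings. (A coloring exists and there are finitely many; the maximum makes sense for
nonempty `𝒮`.) -/
noncomputable def disc {N : ℕ} (𝒮 : SetSystem N) : ℝ :=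
  ⨅ χ : {χ : Fin N → ℤ // IsColoring χ}, ⨆ S : 𝒮, |((∑ s ∈ S.1, χ.1 s : ℤ) : ℝ)|

/-! ### Quantum discrepancy -/

/-- The orthogonal projections of `ℂ^N`, as matrices: `P * P = P` and `Pᴴ = P`. -/
abbrev OrthProj (N : ℕ) := {P : Matrix (Fin N) (Fin N) ℂ // IsStarProjection P}

/-- A projection system in `ℂ^N`: a finite set of orthogonal projections. -/
abbrev ProjectionSystem (N : ℕ) := Finset (OrthProj N)

/-- A quantum coloring: an `N × N` Hermitian matrix with eigenvalues in `{-1, 1}`. -/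
def IsQuantumColoring {N : ℕ} (χ : Matrix (Fin N) (Fin N) ℂ) : Prop :=
  χ.IsHermitian ∧ spectrum ℂ χ ⊆ {-1, 1}

/-- The quantity `(tr (χ P))² + tr (χ [χ, P] P)`, with `[A, B] = A B - B A`. -/
noncomputable def imbalanceSq {N : ℕ} (χ P : Matrix (Fin N) (Fin N) ℂ) : ℂ :=
  (χ * P).trace ^ 2 + (χ * ⁅χ, P⁆ * P).trace

/-- The square root `[(tr (χ P))² + tr (χ [χ, P] P)]^{1/2}`; for a quantum coloring and an
orthogonal projection the radicand is a nonnegative real (see `imbalanceSq_nonneg`). -/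
noncomputable def imbalance {N : ℕ} (χ P : Matrix (Fin N) (Fin N) ℂ) : ℝ :=
  Real.sqrt (imbalanceSq χ P).re

/-- The quantum discrepancy
`min_χ max_{P ∈ ℙ} [(tr (χ P))² + tr (χ [χ, P] P)]^{1/2}`, with `χ` running over all quantum
colorings; the minimum is attained (see `exists_qdisc_eq`), and the maximum makes sense for
nonempty `ℙ`. -/
noncomputable def qdisc {N : ℕ} (ℙ : ProjectionSystem N) : ℝ :=
  ⨅ χ : {χ : Matrix (Fin N) (Fin N) ℂ // IsQuantumColoring χ}, ⨆ P : ℙ, imbalance χ.1 P.1.1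

/-- The orthogonal projection `P_S` onto the span of `{e_i ; i ∈ S}`: the diagonal `0`-`1` matrix
of `S` (see `setProj_eq_starProjection`). -/
noncomputable def setProj {N : ℕ} (S : Finset (Fin N)) : OrthProj N :=
  ⟨Matrix.diagonal fun i => if i ∈ S then 1 else 0, by
    constructor
    · simp [IsIdempotentElem, Matrix.diagonal_mul_diagonal]
    · rw [isSelfAdjoint_iff, Matrix.star_eq_conjTranspose, Matrix.diagonal_conjTranspose]
      congr 1
      ext i
      simp only [Pi.star_apply]
      split_ifs <;> simp⟩

/-- The projection system `𝒫_𝒮 = {P_S ; S ∈ 𝒮}` associated to a set system. -/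
noncomputable def projSystem {N : ℕ} (𝒮 : SetSystem N) : ProjectionSystem N :=
  open scoped Classical in 𝒮.image setProj

/-! ### The definitions above are well posed -/

theorem setProj_eq_starProjection {N : ℕ} (S : Finset (Fin N)) :
    Matrix.toEuclideanLin (setProj S).1 =
      ((Submodule.span ℂ ((fun i => EuclideanSpace.single i (1 : ℂ)) '' (S : Set (Fin N)))
        ).starProjection : EuclideanSpace ℂ (Fin N) →ₗ[ℂ] EuclideanSpace ℂ (Fin N)) := by
  classical
  refine LinearMap.ext fun v => ?_
  rw [ContinuousLinearMap.coe_coe]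
  symm
  apply Submodule.eq_starProjection_of_mem_orthogonal
  · have h : Matrix.toEuclideanLin (setProj S).1 v
        = ∑ i ∈ S, v i • EuclideanSpace.single i (1 : ℂ) := by
      ext j
      simp [setProj, Matrix.toLpLin_apply, Matrix.mulVec_diagonal, Finset.sum_apply,
        Pi.single_apply]
    rw [h]
    exact Submodule.sum_mem _ fun i hi => Submodule.smul_mem _ _
      (Submodule.subset_span ⟨i, hi, rfl⟩)
  · rw [Submodule.mem_orthogonal]
    intro u hu
    induction hu using Submodule.span_induction with
    | mem x hx =>
      obtain ⟨i, hi, rfl⟩ := hx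
      have hi' : i ∈ S := hi
      simp [setProj, Matrix.toLpLin_apply, Matrix.mulVec_diagonal, hi',
        EuclideanSpace.inner_single_left]
    | zero => simp
    | add x y _ _ hx hy => rw [inner_add_left, hx, hy, add_zero]
    | smul a x _ hx => rw [inner_smul_left, hx, mul_zero]

theorem setProj_injective {N : ℕ} : Function.Injective (setProj (N := N)) := by
  intro S T h
  ext i
  have := congrFun (congrFun (congrArg Subtype.val h) i) i
  simp only [setProj, Matrix.diagonal_apply_eq] at this
  by_cases h1 : i ∈ S <;> by_cases h2 : i ∈ T <;> simp_all

theorem card_projSystem {N : ℕ} (𝒮 : SetSystem N) : (projSystem 𝒮).card = 𝒮.card := by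
  classical
  unfold projSystem
  convert Finset.card_image_of_injective 𝒮 setProj_injective

theorem isQuantumColoring_iff {N : ℕ} (χ : Matrix (Fin N) (Fin N) ℂ) :
    IsQuantumColoring χ ↔ χ.IsHermitian ∧ χ * χ = 1 := by
  refine and_congr_right fun h => ⟨fun hs => ?_, fun hs μ hμ => ?_⟩
  · have he : ∀ i, h.eigenvalues i * h.eigenvalues i = 1 := fun i => by
      have hm : ((h.eigenvalues i : ℝ) : ℂ) ∈ spectrum ℂ χ := by
        rw [h.spectrum_eq_image_range]
        exact ⟨_, ⟨i, rfl⟩, rfl⟩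
      rcases hs hm with h1 | h1
      · have : h.eigenvalues i = -1 := by exact_mod_cast h1
        rw [this]; norm_num
      · have : h.eigenvalues i = 1 := by exact_mod_cast Set.mem_singleton_iff.mp h1
        rw [this]; norm_num
    rw [h.spectral_theorem, ← map_mul, Matrix.diagonal_mul_diagonal]
    have : (fun i => (RCLike.ofReal ∘ h.eigenvalues) i * (RCLike.ofReal ∘ h.eigenvalues) i)
        = (fun _ : Fin N => (1 : ℂ)) := by
      funext i
      simp only [Function.comp_apply]
      rw [← RCLike.ofReal_mul, he i, RCLike.ofReal_one]
    rw [this, Matrix.diagonal_one, map_one]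
  · rw [← Matrix.spectrum_toLin'] at hμ
    obtain ⟨v, hv⟩ := (Module.End.hasEigenvalue_iff_mem_spectrum.mpr hμ).exists_hasEigenvector
    have h1 : Matrix.toLin' χ v = μ • v := hv.apply_eq_smul
    have h2 : (μ * μ) • v = (1 : ℂ) • v := by
      calc (μ * μ) • v = Matrix.toLin' χ (Matrix.toLin' χ v) := by
            rw [h1, map_smul, h1, smul_smul]
        _ = (1 : ℂ) • v := by
            rw [← LinearMap.comp_apply, ← Matrix.toLin'_mul, hs]; simp
    have h3 : μ * μ = 1 := smul_left_injective ℂ hv.2 h2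
    rcases mul_self_eq_one_iff.mp h3 with h | h <;> simp [h]

open scoped ComplexOrder in
/-- In the order of `ℂ`: the radicand is real and nonnegative. -/
theorem imbalanceSq_nonneg {N : ℕ} {χ : Matrix (Fin N) (Fin N) ℂ} (hχ : IsQuantumColoring χ)
    (P : OrthProj N) : 0 ≤ imbalanceSq χ P.1 := by
  obtain ⟨hH, h1⟩ := (isQuantumColoring_iff χ).mp hχ
  obtain ⟨P, hP, hPs⟩ := P
  have hPH : P.conjTranspose = P := hPs
  have hPP : P * P = P := hP
  refine add_nonneg ?_ ?_
  · have : star (χ * P).trace = (χ * P).trace := by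
      rw [← Matrix.trace_conjTranspose, Matrix.conjTranspose_mul, hPH, hH, Matrix.trace_mul_comm]
    obtain ⟨r, hr⟩ := Complex.conj_eq_iff_real.mp this
    rw [hr]
    exact_mod_cast sq_nonneg r
  · have hpos := (Matrix.posSemidef_conjTranspose_mul_self ⁅χ, P⁆).trace_nonneg
    have e : (⁅χ, P⁆.conjTranspose * ⁅χ, P⁆).trace = 2 * (χ * ⁅χ, P⁆ * P).trace := by
      have e1 : χ * ⁅χ, P⁆ * P = P - χ * P * χ * P := by
        rw [Ring.lie_def, mul_sub, sub_mul, ← mul_assoc, h1, one_mul, hPP, ← mul_assoc]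
      have e2 : ⁅χ, P⁆.conjTranspose * ⁅χ, P⁆
          = P * (χ * χ) * P - P * χ * P * χ - χ * P * χ * P + χ * (P * P) * χ := by
        rw [Ring.lie_def, Matrix.conjTranspose_sub, Matrix.conjTranspose_mul,
          Matrix.conjTranspose_mul, hPH, hH]
        noncomm_ring
      have e3 : (P * χ * P * χ).trace = (χ * P * χ * P).trace := by
        rw [Matrix.trace_mul_comm (P * χ * P) χ]; simp only [mul_assoc]
      have e4 : (χ * P * χ).trace = P.trace := by
        rw [Matrix.trace_mul_comm, ← mul_assoc, h1, one_mul]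
      rw [e1, e2, h1, hPP, mul_one, hPP, Matrix.trace_add, Matrix.trace_sub, Matrix.trace_sub,
        Matrix.trace_sub, e3, e4]
      ring
    rw [e] at hpos
    have h2 : (0 : ℂ) ≤ 2⁻¹ := by
      rw [show (2⁻¹ : ℂ) = ((2⁻¹ : ℝ) : ℂ) by push_cast; rfl]
      exact Complex.zero_le_real.mpr (by norm_num)
    simpa [← mul_assoc] using mul_nonneg h2 hpos

/-- The minimum in the definition of `qdisc` is attained. -/
theorem exists_qdisc_eq {N : ℕ} (ℙ : ProjectionSystem N) :
    ∃ χ : Matrix (Fin N) (Fin N) ℂ, IsQuantumColoring χ ∧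
      qdisc ℙ = ⨆ P : ℙ, imbalance χ P.1.1 := by
  have hK : IsCompact {χ : Matrix (Fin N) (Fin N) ℂ | IsQuantumColoring χ} := by
    have hb : IsCompact (Set.univ.pi fun _ : Fin N => Set.univ.pi fun _ : Fin N =>
        Metric.closedBall (0 : ℂ) 1) :=
      isCompact_univ_pi fun _ => isCompact_univ_pi fun _ => isCompact_closedBall _ _
    have hcl : IsClosed {χ : Matrix (Fin N) (Fin N) ℂ | IsQuantumColoring χ} := by
      have : T2Space (Matrix (Fin N) (Fin N) ℂ) :=
        inferInstanceAs (T2Space (Fin N → Fin N → ℂ))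
      have e : {χ : Matrix (Fin N) (Fin N) ℂ | IsQuantumColoring χ}
          = {χ | χ.conjTranspose = χ} ∩ {χ | χ * χ = 1} := Set.ext isQuantumColoring_iff
      rw [e]
      exact (isClosed_eq (by fun_prop) continuous_id).inter
        (isClosed_eq (by fun_prop) continuous_const)
    have hbd : ∀ χ : Matrix (Fin N) (Fin N) ℂ, IsQuantumColoring χ → ∀ i j, ‖χ i j‖ ≤ 1 := by
      intro χ hχ i j
      obtain ⟨hH, h1⟩ := (isQuantumColoring_iff χ).mp hχ
      have hU : χ ∈ Matrix.unitaryGroup (Fin N) ℂ := by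
        rw [Matrix.mem_unitaryGroup_iff, Matrix.star_eq_conjTranspose, hH, h1]
      exact entry_norm_bound_of_unitary hU i j
    exact hb.of_isClosed_subset hcl fun χ hχ i _ j _ => by simpa using hbd χ hχ i j
  have hne : {χ : Matrix (Fin N) (Fin N) ℂ | IsQuantumColoring χ}.Nonempty :=
    ⟨1, (isQuantumColoring_iff 1).mpr ⟨Matrix.isHermitian_one, one_mul 1⟩⟩
  have hc : Continuous fun χ : Matrix (Fin N) (Fin N) ℂ => ⨆ P : ℙ, imbalance χ P.1.1 := by
    have h1 : ∀ P : ℙ, Continuous fun χ : Matrix (Fin N) (Fin N) ℂ => imbalance χ P.1.1 := by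
      intro P
      simp only [imbalance, imbalanceSq, Ring.lie_def]
      fun_prop
    rcases isEmpty_or_nonempty ℙ with h | h
    · simp only [Real.iSup_of_isEmpty]
      exact continuous_const
    · simp only [← Finset.sup'_univ_eq_ciSup]
      exact Continuous.finset_sup'_apply _ fun P _ => h1 P
  obtain ⟨χ, hχ, hmin⟩ := hK.exists_isMinOn hne hc.continuousOn
  refine ⟨χ, hχ, le_antisymm ?_ ?_⟩
  · refine ciInf_le ⟨0, ?_⟩ (⟨χ, hχ⟩ : {χ // IsQuantumColoring χ})
    rintro _ ⟨χ', rfl⟩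
    exact Real.iSup_nonneg fun P => Real.sqrt_nonneg _
  · have : Nonempty {χ : Matrix (Fin N) (Fin N) ℂ // IsQuantumColoring χ} := ⟨⟨χ, hχ⟩⟩
    exact le_ciInf fun χ' => hmin χ'.2

/-! A quantum coloring `χ` is rounded to a random coloring. The projection `K = (1 + χ) / 2` is the
kernel of a determinantal point process on `[N]`; a random set `T` with this law gives the coloring
`1` on `T`, `-1` off `T`. For fixed `S`, `|T ∩ S|` is distributed as a sum of independent Bernoulli
variables whose parameters are the eigenvalues of `P_S K P_S`. So the discrepancy of `S` has mean
`tr (χ P)` and variance `tr (χ [χ, P] P)`: the radicand in `qdisc` is its second moment. A Chernoff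
bound (`sum_detWeight_mul_exp_le`) and a union bound over the `M` sets and both signs
(`exists_coloring_abs_le`) give, with `q = qdisc`, `disc ≤ q + log (2M) / l + l q²` for `0 < l ≤
1/2`. The lower bounds on `q` make `l ~ 1/q` in (i) and `l ~ √(log (2M)) / q` in (ii) admissible. -/

/-! ### The determinantal process of a quantum coloring. -/

section Determinantal

open scoped ComplexOrder

variable {n : Type*} [Fintype n] [DecidableEq n]

/-- `A * B` is unitary, so a kernel vector `v` would satisfy `‖v‖ = t ‖v‖` with `t < 1`. -/
theorem Matrix.det_one_add_smul_mul_ne_zero {A B : Matrix n n ℂ} (hA : A.IsHermitian)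
    (hA1 : A * A = 1) (hB : B.IsHermitian) (hB1 : B * B = 1) {t : ℝ} (ht0 : 0 ≤ t) (ht1 : t < 1) :
    (1 + (t : ℂ) • (A * B)).det ≠ 0 := by
  intro h
  obtain ⟨v, hv, h0⟩ := Matrix.exists_mulVec_eq_zero_iff.mpr h
  rw [Matrix.add_mulVec, Matrix.one_mulVec, Matrix.smul_mulVec] at h0
  have hU : (A * B).conjTranspose * (A * B) = 1 := by
    rw [Matrix.conjTranspose_mul, hA.eq, hB.eq, mul_assoc, ← mul_assoc A, hA1, one_mul, hB1]
  have hn : star ((A * B).mulVec v) ⬝ᵥ (A * B).mulVec v = star v ⬝ᵥ v := by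
    rw [Matrix.star_mulVec, ← Matrix.dotProduct_mulVec, Matrix.mulVec_mulVec, hU,
      Matrix.one_mulVec]
  have h1 : v = -((t : ℂ) • (A * B).mulVec v) := eq_neg_of_add_eq_zero_left h0
  have h2 : star v ⬝ᵥ v = ((t ^ 2 : ℝ) : ℂ) * (star v ⬝ᵥ v) := by
    conv_lhs => rw [h1]
    rw [star_neg, neg_dotProduct_neg, star_smul, smul_dotProduct, dotProduct_smul, hn]
    simp only [RCLike.star_def, Complex.conj_ofReal, smul_eq_mul]
    push_cast
    ring
  have h3 : (1 - ((t ^ 2 : ℝ) : ℂ)) * (star v ⬝ᵥ v) = 0 := by linear_combination h2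
  rcases mul_eq_zero.mp h3 with h4 | h4
  · have : (1 : ℝ) = t ^ 2 := by exact_mod_cast sub_eq_zero.mp h4
    nlinarith
  · exact hv (dotProduct_star_self_eq_zero.mp h4)

/-- Along `t ↦ det (1 + t A B)` the determinant is real, because its conjugate is `det (1 + t B A)`.
It starts at `1` and cannot vanish before `t = 1`, so it cannot become negative. -/
theorem Matrix.det_one_add_mul_nonneg {A B : Matrix n n ℂ} (hA : A.IsHermitian)
    (hA1 : A * A = 1) (hB : B.IsHermitian) (hB1 : B * B = 1) : 0 ≤ (1 + A * B).det := by
  set f : ℝ → ℂ := fun t => (1 + (t : ℂ) • (A * B)).det with hf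
  have him : ∀ t, (f t).im = 0 := by
    intro t
    refine Complex.conj_eq_iff_im.mp ?_
    change star (f t) = f t
    simp only [hf]
    rw [← Matrix.det_conjTranspose, Matrix.conjTranspose_add, Matrix.conjTranspose_one,
      Matrix.conjTranspose_smul, Matrix.conjTranspose_mul, hA.eq, hB.eq, RCLike.star_def,
      Complex.conj_ofReal, ← Matrix.smul_mul, Matrix.det_one_add_mul_comm, Matrix.mul_smul]
  have hcont : Continuous fun t => (f t).re := by
    refine Complex.continuous_re.comp (Continuous.matrix_det ?_)
    fun_prop
  have hre : 0 ≤ (f 1).re := by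
    by_contra! hlt
    have h0 : (f 0).re = 1 := by simp [hf]
    obtain ⟨t, ⟨ht0, ht1⟩, ht⟩ := intermediate_value_Icc' zero_le_one hcont.continuousOn
      (⟨hlt.le, h0 ▸ zero_le_one⟩ : (0 : ℝ) ∈ Set.Icc (f 1).re (f 0).re)
    have hne : t ≠ 1 := by rintro rfl; exact hlt.ne ht
    exact Matrix.det_one_add_smul_mul_ne_zero hA hA1 hB hB1 ht0 (lt_of_le_of_ne ht1 hne)
      (Complex.ext ht (him t))
  have : f 1 = (1 + A * B).det := by simp [hf]
  rw [← this, Complex.nonneg_iff]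
  exact ⟨hre, (him 1).symm⟩

/-- The diagonal matrix with entries `1` on `T` and `-1` off `T`. -/
def signMatrix (T : Finset n) : Matrix n n ℂ :=
  Matrix.diagonal fun i => if i ∈ T then 1 else -1

/-- The probability of `T` in the determinantal point process of the projection `(1 + χ) / 2`. -/
noncomputable def detWeight (χ : Matrix n n ℂ) (T : Finset n) : ℝ :=
  ((2⁻¹ : ℂ) • (1 + signMatrix T * χ)).det.re

theorem detWeight_nonneg_and_coe {χ : Matrix n n ℂ} (hH : χ.IsHermitian) (h1 : χ * χ = 1)
    (T : Finset n) : 0 ≤ detWeight χ T ∧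
      (detWeight χ T : ℂ) = ((2⁻¹ : ℂ) • (1 + signMatrix T * χ)).det := by
  have hE : (signMatrix T : Matrix n n ℂ).IsHermitian := by
    rw [signMatrix, Matrix.isHermitian_diagonal_iff]
    intro i
    split_ifs <;> simp [IsSelfAdjoint]
  have hE1 : (signMatrix T : Matrix n n ℂ) * signMatrix T = 1 := by
    rw [signMatrix, Matrix.diagonal_mul_diagonal, ← Matrix.diagonal_one]
    congr 1
    ext i
    split_ifs <;> simp
  have h := Matrix.det_one_add_mul_nonneg hE hE1 hH h1
  have h2 : 0 ≤ ((2⁻¹ : ℂ) • (1 + signMatrix T * χ)).det := by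
    rw [Matrix.det_smul]
    refine mul_nonneg (pow_nonneg ?_ _) h
    rw [show (2⁻¹ : ℂ) = ((2⁻¹ : ℝ) : ℂ) by push_cast; rfl]
    exact Complex.zero_le_real.mpr (by norm_num)
  obtain ⟨h3, h4⟩ := Complex.nonneg_iff.mp h2
  exact ⟨h3, Complex.ext rfl h4⟩

/-- The Laplace functional of the determinantal point process. -/
theorem sum_detWeight_mul_prod {χ : Matrix n n ℂ} (hH : χ.IsHermitian) (h1 : χ * χ = 1)
    (z : n → ℂ) :
    ∑ T : Finset n, (detWeight χ T : ℂ) * ∏ i ∈ T, z i =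
      (1 + Matrix.diagonal (fun i => z i - 1) * ((2⁻¹ : ℂ) • (1 + χ))).det := by
  -- Row `i` is `z i` times row `i` of `K` plus row `i` of `1 - K`. Multilinearity in the rows then
  -- sums over the set `T` of rows taken from `K`.
  have e : (1 + Matrix.diagonal (fun i => z i - 1) * ((2⁻¹ : ℂ) • (1 + χ)) : Matrix n n ℂ) =
      (fun i => z i • ((2⁻¹ : ℂ) • (1 + χ)) i) + fun i => ((2⁻¹ : ℂ) • (1 - χ)) i := by
    ext i j
    simp only [Matrix.add_apply, Matrix.diagonal_mul, Matrix.smul_apply, Matrix.sub_apply,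
      Pi.add_apply, Pi.smul_apply, smul_eq_mul]
    ring
  have := (Matrix.detRowAlternating (n := n) (R := ℂ)).toMultilinearMap.map_add_univ
    (fun i => z i • ((2⁻¹ : ℂ) • (1 + χ)) i) (fun i => ((2⁻¹ : ℂ) • (1 - χ)) i)
  rw [e]
  refine Eq.trans ?_ this.symm
  refine Finset.sum_congr rfl fun T _ => ?_
  rw [(detWeight_nonneg_and_coe hH h1 T).2, mul_comm]
  have e2 : T.piecewise (fun i => z i • ((2⁻¹ : ℂ) • (1 + χ)) i)
      (fun i => ((2⁻¹ : ℂ) • (1 - χ)) i) =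
      (Matrix.of fun i j => (if i ∈ T then z i else 1) *
        ((2⁻¹ : ℂ) • (1 + signMatrix T * χ)) i j : Matrix n n ℂ) := by
    ext i j
    by_cases hi : i ∈ T
    · simp [hi, signMatrix, Matrix.diagonal_mul, mul_add]
    · simp [hi, signMatrix, Matrix.diagonal_mul, sub_eq_add_neg, mul_add]
  rw [e2]
  refine Eq.trans ?_ (Matrix.det_mul_column _ _).symm
  rw [Finset.prod_ite_mem, Finset.univ_inter]

end Determinantal

/-! ### Laplace transforms of sums of independent Bernoulli variables. -/

section Spectral

open scoped ComplexOrder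

variable {n : Type*} [Fintype n] [DecidableEq n]

/-- The determinant becomes the generating function of independent Bernoulli variables of parameters
`κ i`; the traces give their total mean and variance. -/
theorem Matrix.exists_eigenvalues_mem_Icc {A : Matrix n n ℂ} (hA : A.PosSemidef)
    (hA' : (1 - A).PosSemidef) : ∃ κ : n → ℝ, (∀ i, 0 ≤ κ i ∧ κ i ≤ 1) ∧
      (∀ u : ℝ, (1 + (u : ℂ) • A).det = ((∏ i, (1 + u * κ i) : ℝ) : ℂ)) ∧
      A.trace = ((∑ i, κ i : ℝ) : ℂ) ∧ (A * A).trace = ((∑ i, κ i ^ 2 : ℝ) : ℂ) := by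
  have hH := hA.isHermitian
  set U : Matrix n n ℂ := (hH.eigenvectorUnitary : Matrix n n ℂ)
  have hU : star U * U = 1 := Unitary.coe_star_mul_self hH.eigenvectorUnitary
  have hU' : U * star U = 1 := Unitary.coe_mul_star_self hH.eigenvectorUnitary
  set D : Matrix n n ℂ := Matrix.diagonal fun i => (hH.eigenvalues i : ℂ) with hD
  have hs : A = U * D * star U := by
    have := hH.spectral_theorem
    rw [Unitary.conjStarAlgAut_apply] at this
    exact this
  refine ⟨hH.eigenvalues, fun i => ⟨hA.eigenvalues_nonneg i, ?_⟩, fun u => ?_, ?_, ?_⟩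
  · have h2 : star U * (1 - A) * U = 1 - D := by
      rw [mul_sub, sub_mul, mul_one, hU, hs]
      simp only [mul_assoc, hU, mul_one]
      rw [← mul_assoc, hU, one_mul]
    have h3 := (hA'.conjTranspose_mul_mul_same U).diag_nonneg (i := i)
    rw [← Matrix.star_eq_conjTranspose, h2] at h3
    simp only [Matrix.sub_apply, Matrix.one_apply_eq, hD, Matrix.diagonal_apply_eq] at h3
    have h4 : (0 : ℂ) ≤ ((1 - hH.eigenvalues i : ℝ) : ℂ) := by push_cast; exact h3
    linarith [Complex.zero_le_real.mp h4]
  · have h2 : 1 + (u : ℂ) • A = U * (1 + (u : ℂ) • D) * star U := by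
      rw [mul_add, add_mul, mul_one, hU', Matrix.mul_smul, Matrix.smul_mul, ← hs]
    have h3 : (1 + (u : ℂ) • D) =
        Matrix.diagonal fun i => ((1 + u * hH.eigenvalues i : ℝ) : ℂ) := by
      rw [hD, ← Matrix.diagonal_smul, ← Matrix.diagonal_one, Matrix.diagonal_add]
      congr 1
      ext i
      simp
    rw [h2, Matrix.det_mul_right_comm, hU', one_mul, h3, Matrix.det_diagonal]
    push_cast
    rfl
  · rw [hH.trace_eq_sum_eigenvalues]
    push_cast
    rfl
  · have h2 : A * A = U * (D * D) * star U := by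
      rw [hs]
      simp only [mul_assoc]
      rw [← mul_assoc (star U), hU, one_mul]
    rw [h2, Matrix.trace_mul_comm, ← mul_assoc, hU, one_mul, hD, Matrix.diagonal_mul_diagonal,
      Matrix.trace_diagonal]
    push_cast
    exact Finset.sum_congr rfl fun i _ => (sq _).symm

theorem Real.exp_le_one_add_add_sq {x : ℝ} (hx : |x| ≤ 1) : Real.exp x ≤ 1 + x + x ^ 2 := by
  have := (abs_le.mp (Real.abs_exp_sub_one_sub_id_le hx)).2
  linarith

/-- A bound for the centred Laplace transform of a Bernoulli variable. -/
theorem one_add_exp_sub_one_mul_le {s κ : ℝ} (hs : |s| ≤ 1) (h0 : 0 ≤ κ) (h1 : κ ≤ 1) :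
    1 + (Real.exp s - 1) * κ ≤ Real.exp (s * κ + s ^ 2 * (κ - κ ^ 2)) := by
  have ha : |s * (1 - κ)| ≤ 1 := by
    rw [abs_mul, abs_of_nonneg (sub_nonneg.mpr h1)]
    exact mul_le_one₀ hs (sub_nonneg.mpr h1) (by linarith)
  have hb : |-(s * κ)| ≤ 1 := by
    rw [abs_neg, abs_mul, abs_of_nonneg h0]
    exact mul_le_one₀ hs h0 h1
  -- The centred variable is `1 - κ` with probability `κ` and `-κ` otherwise. In `exp x ≤ 1 + x + x
  -- ^ 2` the linear terms cancel and the quadratic ones give the variance `κ - κ ^ 2`.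
  have h2 : κ * Real.exp (s * (1 - κ)) + (1 - κ) * Real.exp (-(s * κ)) ≤
      Real.exp (s ^ 2 * (κ - κ ^ 2)) := by
    have h3 := mul_le_mul_of_nonneg_left (Real.exp_le_one_add_add_sq ha) h0
    have h4 := mul_le_mul_of_nonneg_left (Real.exp_le_one_add_add_sq hb) (sub_nonneg.mpr h1)
    have h5 := Real.add_one_le_exp (s ^ 2 * (κ - κ ^ 2))
    nlinarith
  have h6 : 1 + (Real.exp s - 1) * κ = Real.exp (s * κ) *
      (κ * Real.exp (s * (1 - κ)) + (1 - κ) * Real.exp (-(s * κ))) := by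
    have e1 : Real.exp (s * κ) * Real.exp (s * (1 - κ)) = Real.exp s := by
      rw [← Real.exp_add]; congr 1; ring
    have e2 : Real.exp (s * κ) * Real.exp (-(s * κ)) = 1 := by
      rw [← Real.exp_add, add_neg_cancel, Real.exp_zero]
    linear_combination (-κ) * e1 - (1 - κ) * e2
  rw [h6, Real.exp_add]
  exact mul_le_mul_of_nonneg_left h2 (Real.exp_pos _).le

theorem Matrix.re_det_one_add_smul_le {A : Matrix n n ℂ} (hA : A.PosSemidef)
    (hA' : (1 - A).PosSemidef) {s : ℝ} (hs : |s| ≤ 1) :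
    (1 + ((Real.exp s - 1 : ℝ) : ℂ) • A).det.re ≤
      Real.exp (s * A.trace.re + s ^ 2 * (A.trace.re - (A * A).trace.re)) := by
  obtain ⟨κ, hκ, hdet, htr, htr2⟩ := Matrix.exists_eigenvalues_mem_Icc hA hA'
  rw [hdet, htr, htr2, Complex.ofReal_re, Complex.ofReal_re, Complex.ofReal_re,
    ← Finset.sum_sub_distrib, Finset.mul_sum, Finset.mul_sum, ← Finset.sum_add_distrib,
    Real.exp_sum]
  refine Finset.prod_le_prod (fun i _ => ?_) fun i _ =>
    one_add_exp_sub_one_mul_le hs (hκ i).1 (hκ i).2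
  nlinarith [Real.exp_pos s, hκ i, mul_nonneg (Real.exp_pos s).le (hκ i).1]

end Spectral

/-! ### Concentration of the random coloring and the union bound. -/

section Rounding

open scoped ComplexOrder

variable {N : ℕ}

theorem sum_detWeight {χ : Matrix (Fin N) (Fin N) ℂ} (hχ : IsQuantumColoring χ) :
    ∑ T : Finset (Fin N), detWeight χ T = 1 := by
  obtain ⟨hH, h1⟩ := (isQuantumColoring_iff χ).mp hχ
  have h := sum_detWeight_mul_prod hH h1 fun _ => 1
  have e : (Matrix.diagonal fun _ => (1 : ℂ) - 1 : Matrix (Fin N) (Fin N) ℂ) = 0 := by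
    simp
  rw [e, zero_mul, add_zero, Matrix.det_one] at h
  simp only [Finset.prod_const_one, mul_one] at h
  exact_mod_cast h

/-- The coloring which is `1` on `T` and `-1` off `T`. -/
def signColoring (T : Finset (Fin N)) (i : Fin N) : ℤ := if i ∈ T then 1 else -1

theorem isColoring_signColoring (T : Finset (Fin N)) : IsColoring (signColoring T) := by
  intro i
  by_cases h : i ∈ T <;> simp [signColoring, h]

theorem sum_signColoring (S T : Finset (Fin N)) :
    ((∑ s ∈ S, signColoring T s : ℤ) : ℝ) = 2 * (T ∩ S).card - S.card := by
  have h : ∀ s, (signColoring T s : ℝ) = 2 * (if s ∈ T then 1 else 0) - 1 := by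
    intro s
    by_cases h : s ∈ T <;> simp [signColoring, h]
    norm_num
  push_cast
  simp only [h, Finset.sum_sub_distrib, ← Finset.mul_sum, Finset.sum_boole, Finset.sum_const,
    nsmul_eq_mul, mul_one, Finset.filter_mem_eq_inter, Finset.inter_comm S T]

/-- The mean of the random coloring on the range of `P`. -/
noncomputable def imbalanceMean (χ P : Matrix (Fin N) (Fin N) ℂ) : ℝ := (χ * P).trace.re

/-- The variance of the random coloring on the range of `P`. -/
noncomputable def imbalanceVar (χ P : Matrix (Fin N) (Fin N) ℂ) : ℝ := (χ * ⁅χ, P⁆ * P).trace.re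

theorem imbalanceSq_re {χ : Matrix (Fin N) (Fin N) ℂ} (hχ : IsQuantumColoring χ) (P : OrthProj N) :
    (imbalanceSq χ P.1).re = imbalanceMean χ P.1 ^ 2 + imbalanceVar χ P.1 := by
  have him : (χ * P.1).trace.im = 0 := by
    refine Complex.conj_eq_iff_im.mp ?_
    change star (χ * P.1).trace = _
    have hP : P.1.conjTranspose = P.1 := P.2.2
    rw [← Matrix.trace_conjTranspose, Matrix.conjTranspose_mul, hP, hχ.1.eq, Matrix.trace_mul_comm]
  rw [imbalanceSq, Complex.add_re, sq, Complex.mul_re, him, imbalanceMean, imbalanceVar]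
  ring

/-- The compression `P K P` of the projection `K = (1 + χ) / 2`. -/
noncomputable def compression (χ P : Matrix (Fin N) (Fin N) ℂ) : Matrix (Fin N) (Fin N) ℂ :=
  P * ((2⁻¹ : ℂ) • (1 + χ)) * P

theorem isStarProjection_half_one_add {χ : Matrix (Fin N) (Fin N) ℂ} (hχ : IsQuantumColoring χ) :
    IsStarProjection ((2⁻¹ : ℂ) • (1 + χ)) := by
  obtain ⟨hH, h1⟩ := (isQuantumColoring_iff χ).mp hχ
  constructor
  · rw [IsIdempotentElem, smul_mul_smul_comm, add_mul, one_mul, mul_add, mul_one, h1]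
    module
  · rw [isSelfAdjoint_iff, Matrix.star_eq_conjTranspose, Matrix.conjTranspose_smul,
      Matrix.conjTranspose_add, hH.eq, Matrix.conjTranspose_one]
    simp

theorem compression_posSemidef {χ : Matrix (Fin N) (Fin N) ℂ} (hχ : IsQuantumColoring χ)
    (P : OrthProj N) :
    (compression χ P.1).PosSemidef ∧ (1 - compression χ P.1).PosSemidef := by
  obtain ⟨P, hPs⟩ := P
  have hQs := isStarProjection_half_one_add hχ
  simp only [compression]
  set Q : Matrix (Fin N) (Fin N) ℂ := (2⁻¹ : ℂ) • (1 + χ)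
  have hPP : P * P = P := hPs.1
  have hPH : P.conjTranspose = P := hPs.2
  have hQQ : Q * Q = Q := hQs.1
  have hQH : Q.conjTranspose = Q := hQs.2
  constructor
  · have := Matrix.posSemidef_conjTranspose_mul_self (Q * P)
    rwa [Matrix.conjTranspose_mul, hQH, hPH, mul_assoc, ← mul_assoc Q, hQQ, ← mul_assoc] at this
  · have h3 := (Matrix.posSemidef_conjTranspose_mul_self (1 - P)).add
      (Matrix.posSemidef_conjTranspose_mul_self ((1 - Q) * P))
    have e1 : (1 - P) * (1 - P) = 1 - P := hPs.1.one_sub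
    have e2 : (1 - Q) * (1 - Q) = 1 - Q := hQs.1.one_sub
    rw [Matrix.conjTranspose_mul, Matrix.conjTranspose_sub, Matrix.conjTranspose_sub,
      Matrix.conjTranspose_one, hPH, hQH, e1, mul_assoc, ← mul_assoc (1 - Q), e2, sub_mul,
      mul_sub, one_mul, hPP, ← mul_assoc, sub_add_sub_cancel] at h3
    exact h3

theorem trace_compression_re (χ : Matrix (Fin N) (Fin N) ℂ) (P : OrthProj N) :
    (compression χ P.1).trace.re = (P.1.trace.re + imbalanceMean χ P.1) / 2 := by
  obtain ⟨P, hPs⟩ := P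
  have hPP : P * P = P := hPs.1
  have e : (compression χ P).trace = 2⁻¹ * (P.trace + (χ * P).trace) := by
    rw [compression, Matrix.trace_mul_comm, ← mul_assoc, hPP, Matrix.trace_mul_comm,
      Matrix.smul_mul, Matrix.trace_smul, add_mul, one_mul, Matrix.trace_add, smul_eq_mul]
  rw [e, imbalanceMean, show (2⁻¹ : ℂ) = ((2⁻¹ : ℝ) : ℂ) by push_cast; rfl,
    Complex.re_ofReal_mul, Complex.add_re]
  ring

/-- The left side is the variance of `|T ∩ S|` when `P = P_S`; the factor `4` appears because the
coloring sum is `2 |T ∩ S| - |S|`. -/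
theorem trace_compression_sub_re {χ : Matrix (Fin N) (Fin N) ℂ} (hχ : IsQuantumColoring χ)
    (P : OrthProj N) :
    (compression χ P.1).trace.re - (compression χ P.1 * compression χ P.1).trace.re =
      imbalanceVar χ P.1 / 4 := by
  obtain ⟨hH, h1⟩ := (isQuantumColoring_iff χ).mp hχ
  obtain ⟨P, hPs⟩ := P
  have hPP : P * P = P := hPs.1
  simp only [compression]
  have hQ2 : (2 : ℂ) • ((2⁻¹ : ℂ) • (1 + χ)) = 1 + χ := by rw [smul_smul]; norm_num
  set Q : Matrix (Fin N) (Fin N) ℂ := (2⁻¹ : ℂ) • (1 + χ)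
  have hc : χ = (2 : ℂ) • Q - 1 := eq_sub_of_add_eq' hQ2.symm
  have e1 : (P * Q * P * (P * Q * P)).trace = (Q * P * Q * P).trace := by
    have : P * Q * P * (P * Q * P) = P * (Q * P * Q * P) := by
      calc P * Q * P * (P * Q * P) = P * Q * (P * P) * Q * P := by noncomm_ring
        _ = _ := by rw [hPP]; noncomm_ring
    rw [this, Matrix.trace_mul_comm]
    simp only [mul_assoc, hPP]
  have e0 : (P * Q * P).trace = (Q * P).trace := by
    rw [Matrix.trace_mul_comm, ← mul_assoc, hPP, Matrix.trace_mul_comm]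
  have e2 : (χ * ⁅χ, P⁆ * P).trace = P.trace - (χ * P * χ * P).trace := by
    rw [← Matrix.trace_sub, Ring.lie_def, mul_sub, sub_mul, ← mul_assoc, h1, one_mul, hPP,
      ← mul_assoc]
  have e4 : χ * P * χ * P = (4 : ℂ) • (Q * P * Q * P) - (2 : ℂ) • (Q * (P * P)) -
      (2 : ℂ) • (P * Q * P) + P * P := by
    rw [hc]
    simp only [sub_mul, mul_sub, one_mul, mul_one, Matrix.smul_mul, Matrix.mul_smul, mul_assoc]
    module
  have e6 : (P * Q * P).trace - (P * Q * P * (P * Q * P)).trace =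
      ((4⁻¹ : ℝ) : ℂ) * (χ * ⁅χ, P⁆ * P).trace := by
    rw [e2, e4, hPP, e1, Matrix.trace_add, Matrix.trace_sub, Matrix.trace_sub, Matrix.trace_smul,
      Matrix.trace_smul, Matrix.trace_smul, e0]
    simp only [smul_eq_mul]
    push_cast
    ring
  rw [← Complex.sub_re, e6, Complex.re_ofReal_mul, imbalanceVar]
  ring

theorem imbalanceVar_nonneg {χ : Matrix (Fin N) (Fin N) ℂ} (hχ : IsQuantumColoring χ)
    (P : OrthProj N) : 0 ≤ imbalanceVar χ P.1 := by
  obtain ⟨hpos, hpos'⟩ := compression_posSemidef hχ P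
  obtain ⟨κ, hκ, -, h1, h2⟩ := Matrix.exists_eigenvalues_mem_Icc hpos hpos'
  have h := trace_compression_sub_re hχ P
  rw [h1, h2, Complex.ofReal_re, Complex.ofReal_re, ← Finset.sum_sub_distrib] at h
  have : 0 ≤ ∑ i, (κ i - κ i ^ 2) := Finset.sum_nonneg fun i _ => by nlinarith [hκ i]
  linarith

theorem sum_detWeight_mul_exp_le {χ : Matrix (Fin N) (Fin N) ℂ} (hχ : IsQuantumColoring χ)
    (S : Finset (Fin N)) {l : ℝ} (hl : |l| ≤ 1 / 2) :
    ∑ T : Finset (Fin N), detWeight χ T * Real.exp (l *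
      (((∑ s ∈ S, signColoring T s : ℤ) : ℝ) - imbalanceMean χ (setProj S).1)) ≤
      Real.exp (l ^ 2 * imbalanceVar χ (setProj S).1) := by
  obtain ⟨hH, h1⟩ := (isQuantumColoring_iff χ).mp hχ
  obtain ⟨hpos, hpos'⟩ := compression_posSemidef hχ (setProj S)
  have hvar := trace_compression_sub_re hχ (setProj S)
  have htr := trace_compression_re χ (setProj S)
  set P : Matrix (Fin N) (Fin N) ℂ := (setProj S).1 with hP
  have hPP : P * P = P := (setProj S).2.1
  have htrP : P.trace = (S.card : ℂ) := by simp [hP, setProj, Matrix.trace_diagonal]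
  rw [htrP, Complex.natCast_re] at htr
  set A := compression χ P with hA
  -- The exponent attached to `|T ∩ S|` is `2 * l`, whence the restriction `|l| ≤ 1 / 2`.
  have hs : |2 * l| ≤ 1 := by rw [abs_mul, abs_two]; linarith
  have hdet := Matrix.re_det_one_add_smul_le hpos hpos' hs
  rw [hvar] at hdet
  have hL := sum_detWeight_mul_prod hH h1 fun i => if i ∈ S then (Real.exp (2 * l) : ℂ) else 1
  have e7 : (Matrix.diagonal fun i => (if i ∈ S then (Real.exp (2 * l) : ℂ) else 1) - 1 :
      Matrix (Fin N) (Fin N) ℂ) = ((Real.exp (2 * l) - 1 : ℝ) : ℂ) • P := by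
    rw [hP, setProj, ← Matrix.diagonal_smul]
    congr 1
    ext i
    by_cases hi : i ∈ S <;> simp [hi]
  rw [e7] at hL
  -- Sylvester's identity and `P * P = P` replace `P K` by the Hermitian matrix `P K P`, to which
  -- the spectral bound applies.
  have e8 : (1 + ((Real.exp (2 * l) - 1 : ℝ) : ℂ) • P * ((2⁻¹ : ℂ) • (1 + χ))).det =
      (1 + ((Real.exp (2 * l) - 1 : ℝ) : ℂ) • A).det := by
    rw [hA, compression, ← Matrix.mul_smul, Matrix.det_one_add_mul_comm (P * _), ← mul_assoc,
      Matrix.smul_mul _ P P, hPP]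
  rw [e8] at hL
  have e9 : ∑ T : Finset (Fin N), detWeight χ T * Real.exp (2 * l * (T ∩ S).card) =
      (1 + ((Real.exp (2 * l) - 1 : ℝ) : ℂ) • A).det.re := by
    rw [← hL, Complex.re_sum]
    refine Finset.sum_congr rfl fun T _ => ?_
    rw [Complex.re_ofReal_mul, Finset.prod_ite_mem, Finset.prod_const, ← Complex.ofReal_pow,
      Complex.ofReal_re, ← Real.exp_nat_mul]
    congr 2
    ring
  rw [← e9] at hdet
  have e10 : ∀ T : Finset (Fin N), detWeight χ T * Real.exp (l *
      (((∑ s ∈ S, signColoring T s : ℤ) : ℝ) - imbalanceMean χ P)) =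
      Real.exp (-(2 * l * A.trace.re)) * (detWeight χ T * Real.exp (2 * l * (T ∩ S).card)) := by
    intro T
    rw [sum_signColoring, mul_left_comm, ← Real.exp_add, htr]
    congr 2
    ring
  simp only [e10, ← Finset.mul_sum]
  refine (mul_le_mul_of_nonneg_left hdet (Real.exp_pos _).le).trans_eq ?_
  rw [← Real.exp_add]
  congr 1
  ring

/-- Rounding a quantum coloring to a coloring. -/
theorem exists_coloring_abs_le {χ : Matrix (Fin N) (Fin N) ℂ} (hχ : IsQuantumColoring χ)
    (𝒮 : SetSystem N) {q l : ℝ} (hq : 0 ≤ q) (hl0 : 0 < l) (hl : l ≤ 1 / 2)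
    (hqS : ∀ S ∈ 𝒮, imbalance χ (setProj S).1 ≤ q) :
    ∃ c : Fin N → ℤ, IsColoring c ∧ ∀ S ∈ 𝒮, |((∑ s ∈ S, c s : ℤ) : ℝ)| ≤
      q + (Real.log (2 * (𝒮.card : ℝ)) / l + l * q ^ 2) := by
  obtain ⟨hH, h1⟩ := (isQuantumColoring_iff χ).mp hχ
  set Y : Finset (Fin N) → Finset (Fin N) → ℝ := fun S T =>
    ((∑ s ∈ S, signColoring T s : ℤ) : ℝ) - imbalanceMean χ (setProj S).1 with hY
  have hsq : ∀ S ∈ 𝒮, imbalanceMean χ (setProj S).1 ^ 2 + imbalanceVar χ (setProj S).1 ≤ q ^ 2 := by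
    intro S hS
    rw [← imbalanceSq_re hχ]
    exact (Real.sqrt_le_left hq).mp (hqS S hS)
  -- Summing the exponentials over all `S` and both signs encodes the union bound: one `T` with `G
  -- T` at most its mean bound `B` controls every `S` at once.
  set G : Finset (Fin N) → ℝ := fun T =>
    ∑ S ∈ 𝒮, (Real.exp (l * Y S T) + Real.exp (-l * Y S T)) with hG
  set B : ℝ := 2 * 𝒮.card * Real.exp (l ^ 2 * q ^ 2) with hB
  have hsum : ∑ T : Finset (Fin N), detWeight χ T * G T ≤ B := by
    simp only [hG, Finset.mul_sum]
    rw [Finset.sum_comm]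
    have : ∀ S ∈ 𝒮, ∑ T : Finset (Fin N), detWeight χ T *
        (Real.exp (l * Y S T) + Real.exp (-l * Y S T)) ≤ 2 * Real.exp (l ^ 2 * q ^ 2) := by
      intro S hS
      simp only [mul_add, Finset.sum_add_distrib]
      have ha := sum_detWeight_mul_exp_le hχ S (l := l) (by rwa [abs_of_pos hl0])
      have hb := sum_detWeight_mul_exp_le hχ S (l := -l) (by rwa [abs_neg, abs_of_pos hl0])
      have hc : Real.exp (l ^ 2 * imbalanceVar χ (setProj S).1) ≤ Real.exp (l ^ 2 * q ^ 2) := by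
        gcongr
        nlinarith [hsq S hS, sq_nonneg (imbalanceMean χ (setProj S).1)]
      rw [neg_sq] at hb
      linarith
    refine (Finset.sum_le_sum this).trans_eq ?_
    rw [Finset.sum_const, nsmul_eq_mul, hB]
    ring
  obtain ⟨T, hT⟩ : ∃ T, G T ≤ B := by
    by_contra! hlt
    have hw := sum_detWeight hχ
    have h2 : ∑ T : Finset (Fin N), detWeight χ T * B <
        ∑ T : Finset (Fin N), detWeight χ T * G T := by
      obtain ⟨T, hT, hne⟩ := Finset.exists_ne_zero_of_sum_ne_zero (hw.trans_ne one_ne_zero)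
      refine Finset.sum_lt_sum (fun T _ => mul_le_mul_of_nonneg_left (hlt T).le
        (detWeight_nonneg_and_coe hH h1 T).1) ⟨T, hT, ?_⟩
      exact mul_lt_mul_of_pos_left (hlt T)
        (lt_of_le_of_ne (detWeight_nonneg_and_coe hH h1 T).1 hne.symm)
    rw [← Finset.sum_mul, hw, one_mul] at h2
    exact absurd hsum h2.not_ge
  refine ⟨signColoring T, isColoring_signColoring T, fun S hS => ?_⟩
  have hcard : (0 : ℝ) < 2 * 𝒮.card := by
    have := Finset.card_pos.mpr ⟨S, hS⟩
    positivity
  have hle : Real.exp (l * Y S T) + Real.exp (-l * Y S T) ≤ B :=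
    (Finset.single_le_sum (f := fun S => Real.exp (l * Y S T) + Real.exp (-l * Y S T))
      (fun S _ => by positivity) hS).trans hT
  have hBe : B = Real.exp (Real.log (2 * (𝒮.card : ℝ)) + l ^ 2 * q ^ 2) := by
    rw [Real.exp_add, Real.exp_log hcard]
  rw [hBe] at hle
  have hp : l * Y S T ≤ Real.log (2 * (𝒮.card : ℝ)) + l ^ 2 * q ^ 2 :=
    Real.exp_le_exp.mp (by linarith [Real.exp_pos (-l * Y S T)])
  have hm : -l * Y S T ≤ Real.log (2 * (𝒮.card : ℝ)) + l ^ 2 * q ^ 2 :=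
    Real.exp_le_exp.mp (by linarith [Real.exp_pos (l * Y S T)])
  have hYle : |Y S T| ≤ Real.log (2 * (𝒮.card : ℝ)) / l + l * q ^ 2 := by
    have : |Y S T| * l ≤ (Real.log (2 * (𝒮.card : ℝ)) / l + l * q ^ 2) * l := by
      rw [add_mul, div_mul_cancel₀ _ hl0.ne']
      rcases abs_cases (Y S T) with ⟨h, _⟩ | ⟨h, _⟩ <;> rw [h] <;> nlinarith
    exact le_of_mul_le_mul_right this hl0
  have hmean : |imbalanceMean χ (setProj S).1| ≤ q :=
    abs_le_of_sq_le_sq (by linarith [hsq S hS, imbalanceVar_nonneg hχ (setProj S)]) hq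
  have : ((∑ s ∈ S, signColoring T s : ℤ) : ℝ) = imbalanceMean χ (setProj S).1 + Y S T := by
    simp only [hY]; ring
  rw [this]
  exact (abs_add_le _ _).trans (add_le_add hmean hYle)

theorem disc_le_of_forall {𝒮 : SetSystem N} (h𝒮 : 𝒮.Nonempty) {c : Fin N → ℤ} (hc : IsColoring c)
    {b : ℝ} (hb : ∀ S ∈ 𝒮, |((∑ s ∈ S, c s : ℤ) : ℝ)| ≤ b) : disc 𝒮 ≤ b := by
  have : Nonempty 𝒮 := h𝒮.to_subtype
  refine (ciInf_le ⟨0, ?_⟩ (⟨c, hc⟩ : {χ : Fin N → ℤ // IsColoring χ})).trans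
    (ciSup_le fun S => hb S.1 S.2)
  rintro _ ⟨χ, rfl⟩
  exact Real.iSup_nonneg fun S => abs_nonneg _

theorem disc_le_qdisc_add {𝒮 : SetSystem N} (h𝒮 : 𝒮.Nonempty) {l : ℝ} (hl0 : 0 < l)
    (hl : l ≤ 1 / 2) (hq : 0 ≤ qdisc (projSystem 𝒮)) :
    disc 𝒮 ≤ qdisc (projSystem 𝒮) +
      (Real.log (2 * (𝒮.card : ℝ)) / l + l * qdisc (projSystem 𝒮) ^ 2) := by
  obtain ⟨χ, hχ, hmin⟩ := exists_qdisc_eq (projSystem 𝒮)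
  obtain ⟨c, hc, hS⟩ := exists_coloring_abs_le hχ 𝒮 hq hl0 hl fun S hS => by
    rw [hmin]
    have hmem : setProj S ∈ projSystem 𝒮 := by
      classical
      rw [projSystem, Finset.mem_image]
      exact ⟨S, hS, rfl⟩
    exact le_ciSup (f := fun P : projSystem 𝒮 => imbalance χ P.1.1)
      (Set.finite_range _).bddAbove ⟨setProj S, hmem⟩
  exact disc_le_of_forall h𝒮 hc hS

theorem one_div_mul_disc_lt {𝒮 : SetSystem N} (h𝒮 : 𝒮.Nonempty) {l d : ℝ} (hl0 : 0 < l)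
    (hl : l ≤ 1 / 2) (hd : 0 ≤ d) (hq : 0 ≤ qdisc (projSystem 𝒮))
    (h : Real.log (2 * (𝒮.card : ℝ)) / l + l * qdisc (projSystem 𝒮) ^ 2 <
      d * qdisc (projSystem 𝒮)) :
    qdisc (projSystem 𝒮) > 1 / (d + 1) * disc 𝒮 := by
  have := disc_le_qdisc_add h𝒮 hl0 hl hq
  rw [gt_iff_lt, one_div, inv_mul_lt_iff₀ (by linarith)]
  linarith

/-- Keeps the logarithm away from `0` even for one set, so that additive constants are absorbed into
it. -/
theorem half_lt_log_two_mul_card {𝒮 : SetSystem N} (h𝒮 : 𝒮.Nonempty) :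
    1 / 2 < Real.log (2 * (𝒮.card : ℝ)) := by
  have h1 : (1 : ℝ) ≤ 𝒮.card := by exact_mod_cast Finset.card_pos.mpr h𝒮
  have h2 : Real.log 2 ≤ Real.log (2 * (𝒮.card : ℝ)) :=
    Real.log_le_log two_pos (by linarith)
  linarith [Real.log_two_gt_d9]

end Rounding

theorem mainTheorem4 :
    (∀ ε : ℝ, 0 < ε → ∃ c : ℝ, 0 < c ∧
      ∀ (N M : ℕ) (𝒮 : SetSystem N), 𝒮.Nonempty → 𝒮.card = M →
        ε ≤ qdisc (projSystem 𝒮) →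
        qdisc (projSystem 𝒮) > 1 / (2 * c * Real.log (2 * (M : ℝ)) + 1) * disc 𝒮) ∧
    (∀ α : ℝ, 0 < α → ∃ c : ℝ, 0 < c ∧
      ∀ (N M : ℕ) (𝒮 : SetSystem N), 𝒮.Nonempty → 𝒮.card = M →
        α * Real.sqrt (Real.log (2 * (M : ℝ))) ≤ qdisc (projSystem 𝒮) →
        qdisc (projSystem 𝒮) >
          1 / (2 * c * Real.sqrt (Real.log (2 * (M : ℝ))) + 1) * disc 𝒮) := by
  refine ⟨fun ε hε => ?_, fun α hα => ?_⟩
  · set a := min (ε / 2) 1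
    have ha : 0 < a := lt_min (by linarith) one_pos
    have ha1 : a ≤ 1 := min_le_right _ _
    have ha2 : a ≤ ε / 2 := min_le_left _ _
    refine ⟨2 / a, by positivity, ?_⟩
    rintro N M 𝒮 h𝒮 rfl hq
    have hL := half_lt_log_two_mul_card h𝒮
    set L := Real.log (2 * (𝒮.card : ℝ))
    have hq0 := hε.trans_le hq
    refine one_div_mul_disc_lt h𝒮 (l := a / qdisc (projSystem 𝒮)) (by positivity) ?_
      (by positivity) hq0.le ?_
    · rw [div_le_iff₀ hq0]
      linarith
    · set q := qdisc (projSystem 𝒮)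
      have e : L / (a / q) + a / q * q ^ 2 = (L / a + a) * q := by field_simp
      have h1 : L ≤ L / a := le_div_self (by linarith) ha ha1
      have h2 : 2 * (2 / a) * L = 4 * (L / a) := by ring
      rw [e, h2]
      exact mul_lt_mul_of_pos_right (by linarith) hq0
  -- With `l = a r / q` both error terms are of order `r q`: their sum is `(r / a + a r) q ≤ (2 r /
  -- a) q`, and `c = 2 / a` allows `(4 r / a) q`.
  · set a := min (α / 2) 1
    have ha : 0 < a := lt_min (by linarith) one_pos
    have ha1 : a ≤ 1 := min_le_right _ _
    have ha2 : a ≤ α / 2 := min_le_left _ _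
    refine ⟨2 / a, by positivity, ?_⟩
    rintro N M 𝒮 h𝒮 rfl hq
    have hL := half_lt_log_two_mul_card h𝒮
    set r := Real.sqrt (Real.log (2 * (𝒮.card : ℝ))) with hr
    have hr0 : 0 < r := Real.sqrt_pos.mpr (by linarith)
    have hq0 := (mul_pos hα hr0).trans_le hq
    refine one_div_mul_disc_lt h𝒮 (l := a * r / qdisc (projSystem 𝒮)) (by positivity) ?_
      (by positivity) hq0.le ?_
    · rw [div_le_iff₀ hq0]
      nlinarith
    · rw [← Real.sq_sqrt (by linarith : 0 ≤ Real.log (2 * (𝒮.card : ℝ))), ← hr]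
      set q := qdisc (projSystem 𝒮)
      have e : r ^ 2 / (a * r / q) + a * r / q * q ^ 2 = (r / a + a * r) * q := by field_simp
      have h1 : r ≤ r / a := le_div_self hr0.le ha ha1
      have h2 : 2 * (2 / a) * r = 4 * (r / a) := by ring
      rw [e, h2]
      exact mul_lt_mul_of_pos_right (by nlinarith) hq0
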